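/- **Setting.** Let $G=(V,E)$ be a finite undirected simple graph with $n=|V|\ge 3$ and real edge lengths at least $1$; let $d\ge 2$ be an integer, $c\ge 1$ and $\epsilon>0$ real, and let $D\subseteq V$ with $|D|\le d$. Put $k=\ln n$, $\epsilon_1=\frac{\epsilon}{2+\epsilon}$, $\epsilon_5=\frac{\epsilon_1}{4k-2}$. Write $|P|$ for the length of a path $P$, $\delta_F$ for the distance in a graph $F$, and $\pi_F(x,y)$ for a shortest $x$-$y$ path in $F$. (Shortest paths need not be unique; the statement holds for every choice. If there is no $x$-$y$ path in $F$, then $\pi_F(x,y)$ does not exist.) $P_1\circ P_2$ is the concatenation of $P_1$ and $P_2$; as it may visit a vertex twice, the vertices of a path are always referred to by their positions on it. *Tree covers.* For disjoint $R,S\subseteq V$, an $S$-restricted tree cover of $G-R$ consists of one tree $T(r)\subseteq G-R$ rooted at $r$ for each $r\in S$, such that (i) for all $x\in S$ and all $y$ connected to $x$ in $G-R$ there is $r\in S$ with $x,y\in V(T(r))$ and $\mathrm{dep}_{T(r)}(x)+\mathrm{dep}_{T(r)}(y)\le(2k-1)\,\delta_{G-R}(x,y)$, where $\mathrm{dep}$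 is the weighted distance to the root in the tree; and (ii) every vertex is in at most $kn^{1/k}(\ln n+1)$ of the trees. Fix any choice of such covers, one for each pair of disjoint $R,S$; for arbitrary $R,S\subseteq V$ let $\mathcal T_R(S)$ be the chosen $(S\setminus R)$-restricted cover of $G-R$, and $\mathcal T(S)=\mathcal T_\emptyset(S)$. For a tree $T$ of $\mathcal T_R(S)$, a *trunk vertex* of $T$ is a vertex of $T$ on the $T$-path between two vertices of $S\setminus R$. The pseudo-degree of $v$ in $T$ is the number of trunk vertices adjacent to $v$ in $T$ if $v$ is a trunk vertex, and $0$ otherwise. Let $\mathrm{Hi}(\mathcal T_R(S))$ be the set of vertices whose pseudo-degree in some tree of $\mathcal T_R(S)$ exceeds $4e\,d^{c+1}\ln^2 n+1$. *Hierarchy.* The hierarchy tree has root $V$. A node $U$ with $\mathrm{Hi}(\mathcal T(U))=\emptyset$ is a leaf; any other node $U$ has the children $W_1,\dots,W_d$, where $W_1=\mathrm{Hi}(\mathcal T(U))$ and $W_i=W_{i-1}\cup\mathrm{Hi}(\mathcal T_{W_{i-1}}(U))$ for $2\le i\le d$. Fix any path $V=U_1,U_2,\dots,U_p$ ($p\ge1$)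 in this tree starting at the root, and put $U_{p+1}=\emptyset$. The level of a vertex $v$ is the largest $l\le p$ with $v\in U_l$, and $G_l$ is the subgraph of $G$ induced by the vertices of level at most $l$. *The set $V(H)$.* For $f\in D$ let $N(f)$ be the set of all vertices that, in some tree $T\ni f$ belonging to $\bigcup_{i=1}^p\mathcal T_{U_{i+1}}(U_i)$, are the parent of $f$ or are a child of $f$ and a trunk vertex of $T$. For given query vertices $s,t\in V$ put $V(H)=\bigl(\{s,t\}\cup\bigcup_{f\in D}N(f)\bigr)\setminus D$. *Far-away paths.* A path $P$ from $a$ to $b$ is $\epsilon_1$-far away from $V(H)$ if there are no inner position of $P$, with vertex $x$, and no $z\in V(H)$ connected to $x$ in $G-D$ such that $|\pi_{G-D}(x,z)|\le\epsilon_1\min\{|P[a,x]|,|P[x,b]|\}$. *Segments.* Two inner positions $x,y$ of a path $P$ from $a$ to $b$ are in the same $\epsilon_5$-segment if either $|P[a,x]|,|P[a,y]|\le|P|/2$ and $\lfloor\log_{1+\epsilon_5}|P[a,x]|\rfloor=\lfloor\log_{1+\epsilon_5}|P[a,y]|\rfloor$, or $|P[x,b]|,|P[y,b]|<|P|/2$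 and $\lfloor\log_{1+\epsilon_5}|P[x,b]|\rfloor=\lfloor\log_{1+\epsilon_5}|P[y,b]|\rfloor$. An $\epsilon_5$-segment of $P$ is the subpath from the leftmost to the rightmost position of a class of this relation. $P$ is an *$\epsilon_5$-segment bipath* if for each of its $\epsilon_5$-segments $P[x,y]$ there are levels $1\le i,j\le p$ and a vertex $z$ on $P[x,y]$ such that $P[x,y]$ is the concatenation of a shortest $x$-$z$ path in $G_i$ and a shortest $z$-$y$ path in $G_j$. **Theorem.** Let $s,t,u,v,w\in V$ and let $P=\pi_{G-D}(u,v)\circ\pi_{G-D}(v,w)$. If $P$ is $\epsilon_1$-far away from $V(H)$, then $P$ is an $\epsilon_5$-segment bipath. -/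

import Mathlib

open SimpleGraph

namespace VSDO

noncomputable section

/-! ### Weighted walks and shortest paths in induced subgraphs -/

/-- The length `|P|` of a walk `P`: the sum of the lengths of the edges it traverses. -/
def wlen {V : Type*} (wt : Sym2 V → ℝ) {H : SimpleGraph V} {x y : V} (P : H.Walk x y) : ℝ :=
  (P.edges.map wt).sum

/-- `P` is a shortest path from `x` to `y` in the induced subgraph `G[A]`: it uses vertices of `A`
only, and no walk of `G` inside `A` from `x` to `y` is shorter. -/
def IsShortestIn {V : Type*} (G : SimpleGraph V) (wt : Sym2 V → ℝ) (A : Set V) {x y : V}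
    (P : G.Walk x y) : Prop :=
  (∀ a ∈ P.support, a ∈ A) ∧
    ∀ Q : G.Walk x y, (∀ a ∈ Q.support, a ∈ A) → wlen wt P ≤ wlen wt Q

/-! ### Rooted trees -/

/-- `T` is a tree (a subgraph of `G`) and `r` is one of its vertices. -/
def IsRootedTree {V : Type*} {G : SimpleGraph V} (T : G.Subgraph) (r : V) : Prop :=
  T.coe.IsTree ∧ r ∈ T.verts

/-- In the tree `T` rooted at `r`, the vertex `x` has (weighted) depth `a`. -/
def HasDepth {V : Type*} {G : SimpleGraph V} (wt : Sym2 V → ℝ) (T : G.Subgraph) (r x : V)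
    (a : ℝ) : Prop :=
  x ∈ T.verts ∧ ∃ P : T.spanningCoe.Walk x r, P.IsPath ∧ wlen wt P = a

/-- In the tree `T` rooted at `r`, the vertex `g` is the parent of `f`: the second vertex of the
tree path from `f` to `r`. -/
def IsParent {V : Type*} {G : SimpleGraph V} (T : G.Subgraph) (r f g : V) : Prop :=
  ∃ P : T.spanningCoe.Walk f r, P.IsPath ∧ 0 < P.length ∧ P.getVert 1 = g

/-- The trunk vertices of `T` with respect to the source set `S`: the vertices of `T` that lie on
the path in `T` between two vertices of `S`. -/
def trunk {V : Type*} {G : SimpleGraph V} (T : G.Subgraph) (S : Set V) : Set V :=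
  {v | v ∈ T.verts ∧ ∃ a ∈ S, ∃ b ∈ S, ∃ P : T.spanningCoe.Walk a b, P.IsPath ∧ v ∈ P.support}

/-- The pseudo-degree of `v` in `T`: its degree in the subgraph of `T` induced by the trunk
vertices, and `0` if `v` is not a trunk vertex. -/
def pdeg {V : Type*} {G : SimpleGraph V} (T : G.Subgraph) (S : Set V) (v : V) : ℕ :=
  {g | v ∈ trunk T S ∧ g ∈ trunk T S ∧ T.Adj v g}.ncard

/-! ### Source-restricted tree covers -/

/-- The parameter `k = ln n`, where `n` is the number of vertices of the input graph. -/
def kpar (V : Type*) [Fintype V] : ℝ := Real.log (Fintype.card V)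

/-- `T` is an `S`-restricted tree cover of `G - R`: a tree `T r` in `G - R` rooted at `r` for every
`r ∈ S`, such that for all `x ∈ S` and all `y` connected to `x` in `G - R` some tree contains both
and `dep x + dep y ≤ (2k - 1) δ_{G-R}(x, y)`, and such that no vertex is in more than
`k n^{1/k} (ln n + 1)` trees. -/
structure IsTreeCover {V : Type*} [Fintype V] (G : SimpleGraph V) (wt : Sym2 V → ℝ) (R S : Set V)
    (T : V → G.Subgraph) : Prop where
  tree : ∀ r ∈ S, IsRootedTree (T r) r ∧ (T r).verts ⊆ Rᶜ
  stretch : ∀ x ∈ S, ∀ y, ∀ P : G.Walk x y, IsShortestIn G wt Rᶜ P →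
    ∃ r ∈ S, ∃ a b : ℝ, HasDepth wt (T r) r x a ∧ HasDepth wt (T r) r y b ∧
      a + b ≤ (2 * kpar V - 1) * wlen wt P
  overlap : ∀ v, (({r | r ∈ S ∧ v ∈ (T r).verts}.ncard : ℕ) : ℝ) ≤
    kpar V * (Fintype.card V : ℝ) ^ (1 / kpar V) * (Real.log (Fintype.card V) + 1)

/-- A choice, for all `R` and all `S ⊆ V \ R`, of an `S`-restricted tree cover `cov R S` of `G - R`.
The cover `𝒯_R(S)` is then `cov R (S \ R)`, and `𝒯(S)` is `cov ∅ S`. -/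
def IsCoverChoice {V : Type*} [Fintype V] (G : SimpleGraph V) (wt : Sym2 V → ℝ)
    (cov : Set V → Set V → V → G.Subgraph) : Prop :=
  ∀ R S : Set V, Disjoint S R → IsTreeCover G wt R S (cov R S)

/-! ### The high-degree hierarchy -/

/-- The degree threshold `s = 4 e d^{c+1} ln² n + 1`. -/
def threshold (V : Type*) [Fintype V] (d : ℕ) (c : ℝ) : ℝ :=
  4 * Real.exp 1 * (d : ℝ) ^ (c + 1) * Real.log (Fintype.card V) ^ 2 + 1

/-- `Hi(𝒯_R(S))`: the vertices whose pseudo-degree in some tree of `𝒯_R(S)` exceeds the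
threshold. -/
def Hi {V : Type*} [Fintype V] {G : SimpleGraph V} (d : ℕ) (c : ℝ)
    (cov : Set V → Set V → V → G.Subgraph) (R S : Set V) : Set V :=
  {v | ∃ r ∈ S \ R, threshold V d c < (pdeg (cov R (S \ R) r) (S \ R) v : ℝ)}

/-- The sets `W_0 = ∅`, `W_1 = Hi(𝒯(U))`, `W_{j+1} = W_j ∪ Hi(𝒯_{W_j}(U))`; for `1 ≤ j ≤ d`
these are the children of the node `U` of the hierarchy tree, if `U` is not a leaf. -/
def childSet {V : Type*} [Fintype V] {G : SimpleGraph V} (d : ℕ) (c : ℝ)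
    (cov : Set V → Set V → V → G.Subgraph) (U : Set V) : ℕ → Set V
  | 0 => ∅
  | j + 1 => childSet d c cov U j ∪ Hi d c cov (childSet d c cov U j) U

/-- `U_1 = V, U_2, …, U_p` is a path in the hierarchy tree that starts in the root, and
`U_{p+1} = ∅` by convention. (A node `U` with `Hi(𝒯(U)) = ∅` is a leaf.) -/
structure IsHierarchyPath {V : Type*} [Fintype V] {G : SimpleGraph V} (d : ℕ) (c : ℝ)
    (cov : Set V → Set V → V → G.Subgraph) (p : ℕ) (U : ℕ → Set V) : Prop where
  one_le : 1 ≤ p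
  root : U 1 = Set.univ
  child : ∀ i, 1 ≤ i → i < p →
    (Hi d c cov ∅ (U i)).Nonempty ∧ ∃ j, 1 ≤ j ∧ j ≤ d ∧ U (i + 1) = childSet d c cov (U i) j
  last : U (p + 1) = ∅

/-- The level of `v`: the largest `l` with `v ∈ U_l`. -/
def level {V : Type*} (p : ℕ) (U : ℕ → Set V) (v : V) : ℕ :=
  sSup {l | 1 ≤ l ∧ l ≤ p ∧ v ∈ U l}

/-- The vertex set of `G_i`, the subgraph of `G` induced by the vertices of level at most `i`. -/
def lowVerts {V : Type*} (p : ℕ) (U : ℕ → Set V) (i : ℕ) : Set V :=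
  {v | level p U v ≤ i}

/-! ### The vertex set of the auxiliary graph -/

/-- `N_T(f)` for the tree `T` rooted at `r`, with source set `S`: the parent of `f` and those
children of `f` that are trunk vertices. -/
def treeNbrs {V : Type*} {G : SimpleGraph V} (T : G.Subgraph) (S : Set V) (r f : V) : Set V :=
  {g | IsParent T r f g ∨ (IsParent T r g f ∧ g ∈ trunk T S)}

/-- `N(f)`: the union of `N_T(f)` over all trees `T ∋ f` of `𝒯_{U_{i+1}}(U_i)`, `1 ≤ i ≤ p`. -/
def failNbrs {V : Type*} {G : SimpleGraph V} (cov : Set V → Set V → V → G.Subgraph) (p : ℕ)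
    (U : ℕ → Set V) (f : V) : Set V :=
  {g | ∃ i, 1 ≤ i ∧ i ≤ p ∧ ∃ r ∈ U i \ U (i + 1),
    f ∈ (cov (U (i + 1)) (U i \ U (i + 1)) r).verts ∧
    g ∈ treeNbrs (cov (U (i + 1)) (U i \ U (i + 1)) r) (U i \ U (i + 1)) r f}

/-- `V(H)` for the query with end vertices `s`, `t` and failure set `D`. -/
def auxVerts {V : Type*} {G : SimpleGraph V} (cov : Set V → Set V → V → G.Subgraph) (p : ℕ)
    (U : ℕ → Set V) (D : Set V) (s t : V) : Set V :=
  ({s, t} ∪ ⋃ f ∈ D, failNbrs cov p U f) \ D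

/-! ### Segments, far-away paths, segment bipaths

The vertices of a path are addressed by their positions, as a path may visit a vertex twice. -/

/-- The inner positions `i` and `j` of `P` are in the same `ε`-segment of `P`. -/
def SameSegment {V : Type*} {G : SimpleGraph V} (wt : Sym2 V → ℝ) (ε : ℝ) {x y : V}
    (P : G.Walk x y) (i j : ℕ) : Prop :=
  (0 < i ∧ i < P.length) ∧ (0 < j ∧ j < P.length) ∧
    ((wlen wt (P.take i) ≤ wlen wt P / 2 ∧ wlen wt (P.take j) ≤ wlen wt P / 2 ∧
        ⌊Real.logb (1 + ε) (wlen wt (P.take i))⌋ = ⌊Real.logb (1 + ε) (wlen wt (P.take j))⌋) ∨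
      (wlen wt (P.drop i) < wlen wt P / 2 ∧ wlen wt (P.drop j) < wlen wt P / 2 ∧
        ⌊Real.logb (1 + ε) (wlen wt (P.drop i))⌋ = ⌊Real.logb (1 + ε) (wlen wt (P.drop j))⌋))

/-- `l` and `r` are the leftmost and the rightmost position of an `ε`-segment of `P`. -/
def IsSegment {V : Type*} {G : SimpleGraph V} (wt : Sym2 V → ℝ) (ε : ℝ) {x y : V}
    (P : G.Walk x y) (l r : ℕ) : Prop :=
  SameSegment wt ε P l r ∧ ∀ m, SameSegment wt ε P l m → l ≤ m ∧ m ≤ r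

/-- `P` is `ε`-far away from the vertex set `X` (with respect to distances in `G - D`). -/
def FarAway {V : Type*} {G : SimpleGraph V} (wt : Sym2 V → ℝ) (D X : Set V) (ε : ℝ) {x y : V}
    (P : G.Walk x y) : Prop :=
  ¬ ∃ m, 0 < m ∧ m < P.length ∧ ∃ z ∈ X, ∃ Q : G.Walk (P.getVert m) z,
    IsShortestIn G wt Dᶜ Q ∧ wlen wt Q ≤ ε * min (wlen wt (P.take m)) (wlen wt (P.drop m))

/-- `P` is an `ε`-segment bipath: every `ε`-segment of `P` is the concatenation of a shortest path
in `G_i` and a shortest path in `G_j` for two levels `i`, `j`. -/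
def IsSegmentBipath {V : Type*} {G : SimpleGraph V} (wt : Sym2 V → ℝ) (p : ℕ) (U : ℕ → Set V)
    (ε : ℝ) {x y : V} (P : G.Walk x y) : Prop :=
  ∀ l r, IsSegment wt ε P l r →
    ∃ i j, (1 ≤ i ∧ i ≤ p) ∧ (1 ≤ j ∧ j ≤ p) ∧
      ∃ (z : V) (A : G.Walk ((P.take r).getVert l) z) (B : G.Walk z (P.getVert r)),
        (P.take r).drop l = A.append B ∧
        IsShortestIn G wt (lowVerts p U i) A ∧ IsShortestIn G wt (lowVerts p U j) B

end

end VSDO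

/-! A segment of `P` is a subwalk of two joined shortest paths, so it splits into at most two
shortest paths of `G - D` (`exists_take_drop_eq_append`). Each such piece `A` is shortest in `G_i`,
with `i` the highest level on `A`. Otherwise a shorter walk `Q` in `G_i` joins its ends and must
meet some `f ∈ D`. From a level-`i` vertex `a` of `A`, going back along `A` and then along `Q`
reaches `f` within `2|A|` while avoiding `U_{i+1}`. The cover of `G - U_{i+1}` therefore has a tree
in which the depths of `a` and `f` sum to at most `(4k - 2)|A|`. On the tree walk from `a` via the
root to `f`, the last vertex before `D` lies in `V(H)` (`exists_treeNbr_near`), so `V(H)` is that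
close to `a` in `G - D`. But segments are short (`SameSegment.wlen_le`), and `(4k - 2) ε₅ = ε₁`,
which contradicts far-awayness. -/

namespace VSDO

/-! ### Lengths of walks -/

section Length

variable {V : Type*} {G : SimpleGraph V} {wt : Sym2 V → ℝ}

theorem wlen_copy {x x' y : V} (h : x = x') (P : G.Walk x y) :
    wlen wt (P.copy h rfl) = wlen wt P := by
  subst h
  rfl

theorem wlen_append {x y z : V} (P : G.Walk x y) (Q : G.Walk y z) :
    wlen wt (P.append Q) = wlen wt P + wlen wt Q := by
  simp [wlen, Walk.edges_append]

theorem wlen_reverse {x y : V} (P : G.Walk x y) : wlen wt P.reverse = wlen wt P := by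
  simp [wlen, Walk.edges_reverse, List.sum_reverse]

theorem wlen_mapLe {H : SimpleGraph V} (h : H ≤ G) {x y : V} (P : H.Walk x y) :
    wlen wt (P.mapLe h) = wlen wt P := by
  simp only [wlen, Walk.edges_mapLe_eq_edges]

theorem wlen_take_add_wlen_drop {x y : V} (P : G.Walk x y) (i : ℕ) :
    wlen wt (P.take i) + wlen wt (P.drop i) = wlen wt P := by
  rw [← wlen_append, Walk.append_take_drop_eq]

theorem wlen_nonneg (hwt : ∀ e ∈ G.edgeSet, 1 ≤ wt e) {x y : V} (P : G.Walk x y) :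
    0 ≤ wlen wt P := by
  refine List.sum_nonneg fun a ha => ?_
  obtain ⟨e, he, rfl⟩ := List.mem_map.1 ha
  exact zero_le_one.trans (hwt e (P.edges_subset_edgeSet he))

theorem wlen_pos (hwt : ∀ e ∈ G.edgeSet, 1 ≤ wt e) {x y : V} (P : G.Walk x y)
    (hP : 0 < P.length) : 0 < wlen wt P := by
  cases P with
  | nil => simp at hP
  | @cons _ z _ h Q =>
    have h1 : 1 ≤ wt s(x, z) := hwt _ (G.mem_edgeSet.2 h)
    have h2 := wlen_nonneg hwt Q
    have h3 : wlen wt (Walk.cons h Q) = wt s(x, z) + wlen wt Q := by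
      simp [wlen]
    linarith

theorem wlen_le_of_edges_sublist (hwt : ∀ e ∈ G.edgeSet, 1 ≤ wt e) {x y x' y' : V}
    {P : G.Walk x y} {Q : G.Walk x' y'} (h : P.edges.Sublist Q.edges) :
    wlen wt P ≤ wlen wt Q := by
  refine (h.map wt).sum_le_sum fun a ha => ?_
  obtain ⟨e, he, rfl⟩ := List.mem_map.1 ha
  exact zero_le_one.trans (hwt e (Q.edges_subset_edgeSet he))

theorem wlen_take_mono (hwt : ∀ e ∈ G.edgeSet, 1 ≤ wt e) {x y : V} (P : G.Walk x y) {i j : ℕ}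
    (h : i ≤ j) : wlen wt (P.take i) ≤ wlen wt (P.take j) :=
  wlen_le_of_edges_sublist hwt (P.take_isSubwalk_take h).edges_isInfix.sublist

theorem wlen_drop_anti (hwt : ∀ e ∈ G.edgeSet, 1 ≤ wt e) {x y : V} (P : G.Walk x y) {i j : ℕ}
    (h : i ≤ j) : wlen wt (P.drop j) ≤ wlen wt (P.drop i) :=
  wlen_le_of_edges_sublist hwt (P.drop_isSubwalk_drop h).edges_isInfix.sublist

theorem wlen_take_take {x y : V} (P : G.Walk x y) {i j : ℕ} (h : i ≤ j) :
    wlen wt ((P.take j).take i) = wlen wt (P.take i) := by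
  simp only [wlen, Walk.edges_take, List.take_take, min_eq_left h]

end Length

/-! ### Shortest paths -/

section Shortest

variable {V : Type*} {G : SimpleGraph V} {wt : Sym2 V → ℝ} {A : Set V}

/-- There are finitely many paths, and removing the loops of a walk neither lengthens it nor leaves
`A`. -/
theorem exists_isShortestIn [Finite V] (hwt : ∀ e ∈ G.edgeSet, 1 ≤ wt e) {x y : V}
    (Q : G.Walk x y) (hQ : ∀ a ∈ Q.support, a ∈ A) : ∃ P : G.Walk x y, IsShortestIn G wt A P := by
  classical
  have := Fintype.ofFinite V
  obtain ⟨P, hPA, hP⟩ := Set.exists_min_image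
    {P : G.Path x y | ∀ a ∈ (P : G.Walk x y).support, a ∈ A} (fun P => wlen wt (P : G.Walk x y))
    (Set.toFinite _) ⟨⟨Q.bypass, Q.bypass_isPath⟩,
      fun a ha => hQ a (Q.support_bypass_subset_support ha)⟩
  refine ⟨P, hPA, fun R hR => (hP ⟨R.bypass, R.bypass_isPath⟩
    fun a ha => hR a (R.support_bypass_subset_support ha)).trans ?_⟩
  exact wlen_le_of_edges_sublist hwt R.edges_bypass_sublist_edges

theorem isShortestIn_copy {x x' y : V} {P : G.Walk x y} (h : x = x') :
    IsShortestIn G wt A (P.copy h rfl) ↔ IsShortestIn G wt A P := by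
  subst h
  rfl

/-- Exchange argument: a shorter replacement of the subwalk would shorten all of `Q`. -/
theorem IsShortestIn.of_isSubwalk {x y x' y' : V} {P : G.Walk x y} {Q : G.Walk x' y'}
    (hQ : IsShortestIn G wt A Q) (h : P.IsSubwalk Q) : IsShortestIn G wt A P := by
  refine ⟨fun a ha => hQ.1 a (h.support_subset ha), fun R hR => ?_⟩
  obtain ⟨X, Y, rfl⟩ := h
  have := hQ.2 ((X.append R).append Y) fun a ha => by
    simp only [Walk.mem_support_append_iff] at ha
    rcases ha with (ha | ha) | ha
    · exact hQ.1 a (by simp [Walk.mem_support_append_iff, ha])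
    · exact hR a ha
    · exact hQ.1 a (by simp [Walk.mem_support_append_iff, ha])
  simp only [wlen_append] at this
  linarith

/-- A subwalk of a concatenation splits into a subwalk of the first and one of the second part,
both of which are shortest if the parts of the concatenation are. -/
theorem exists_take_drop_eq_append {u v w : V} {P₁ : G.Walk u v} {P₂ : G.Walk v w}
    (hP₁ : IsShortestIn G wt A P₁) (hP₂ : IsShortestIn G wt A P₂) {P : G.Walk u w}
    (hP : P = P₁.append P₂) {l r : ℕ} (hlr : l ≤ r) (hr : r ≤ P.length) :
    ∃ (z : V) (X : G.Walk ((P.take r).getVert l) z) (Y : G.Walk z (P.getVert r)),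
      (P.take r).drop l = X.append Y ∧ IsShortestIn G wt A X ∧ IsShortestIn G wt A Y := by
  set W := (P.take r).drop l with hW
  have hl₁ : P₁.support.length = P₁.length + 1 := P₁.length_support
  have hl₂ : P₁.support.dropLast.length = P₁.length := by rw [List.length_dropLast, hl₁]; rfl
  -- The joint `v` belongs to both parts; the two decompositions assign it to `P₁` and to `P₂`
  -- respectively.
  have hs₁ : P.support = P₁.support ++ P₂.support.tail := by rw [hP, Walk.support_append]
  have hs₂ : P.support = P₁.support.dropLast ++ P₂.support := by
    rw [hP, Walk.support_append_eq_support_dropLast_append]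
  have hWlen : W.length = r - l := by rw [hW, Walk.drop_length, Walk.take_length]; omega
  have hWs : W.support = (P.support.take (r + 1)).drop l := by
    rw [hW, Walk.drop_support_eq_support_drop_min, Walk.support_take, Walk.take_length]
    congr 1
    omega
  -- The cut is at `v`. If `W` lies within one part, truncated subtraction or overshooting makes one
  -- piece trivial.
  refine ⟨_, W.take (P₁.length - l), W.drop (P₁.length - l),
    (W.append_take_drop_eq _).symm, ?_⟩
  by_cases hr₁ : r ≤ P₁.length
  · have h : IsShortestIn G wt A W := by
      refine hP₁.of_isSubwalk (Walk.isSubwalk_iff_support_isInfix.2 ?_)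
      rw [hWs, hs₁, List.take_append_of_le_length (by omega)]
      exact (List.drop_suffix _ _).isInfix.trans (List.take_prefix _ _).isInfix
    exact ⟨h.of_isSubwalk (W.isSubwalk_take _), h.of_isSubwalk (W.isSubwalk_drop _)⟩
  by_cases hl : P₁.length ≤ l
  · have h : IsShortestIn G wt A W := by
      refine hP₂.of_isSubwalk (Walk.isSubwalk_iff_support_isInfix.2 ?_)
      rw [hWs, hs₂, List.take_append, List.drop_append, List.drop_eq_nil_of_le
        ((List.length_take_le' _ _).trans (by omega)), List.nil_append]
      exact (List.drop_suffix _ _).isInfix.trans (List.take_prefix _ _).isInfix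
    exact ⟨h.of_isSubwalk (W.isSubwalk_take _), h.of_isSubwalk (W.isSubwalk_drop _)⟩
  refine ⟨hP₁.of_isSubwalk (Walk.isSubwalk_iff_support_isInfix.2 ?_),
    hP₂.of_isSubwalk (Walk.isSubwalk_iff_support_isInfix.2 ?_)⟩
  · rw [Walk.support_take, hWs, hs₁, List.take_drop, List.take_take,
      List.take_append_of_le_length (by omega)]
    exact (List.drop_suffix _ _).isInfix.trans (List.take_prefix _ _).isInfix
  · rw [Walk.drop_support_eq_support_drop_min, hWlen, min_eq_left (by omega), hWs, hs₂,
      List.drop_drop, List.take_append, List.drop_append, List.drop_eq_nil_of_le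
        ((List.length_take_le' _ _).trans (by omega)), List.nil_append]
    exact (List.drop_suffix _ _).isInfix.trans (List.take_prefix _ _).isInfix

end Shortest

/-! ### Leaving a set along a tree path -/

section Tree

variable {V : Type*} {G : SimpleGraph V} {wt : Sym2 V → ℝ}

/-- A walk that starts outside `D` and meets `D` has a first edge that enters `D`. -/
theorem exists_first_mem {D : Set V} {x y : V} (P : G.Walk x y) (hx : x ∉ D)
    (hD : ∃ a ∈ P.support, a ∈ D) :
    ∃ (g f : V) (X : G.Walk x g) (h : G.Adj g f) (Y : G.Walk f y),
      P = X.append (Walk.cons h Y) ∧ f ∈ D ∧ ∀ a ∈ X.support, a ∉ D := by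
  induction P with
  | nil =>
    obtain ⟨a, ha, haD⟩ := hD
    rw [Walk.mem_support_nil_iff] at ha
    exact absurd (ha ▸ haD) hx
  | @cons x' y' z' h Q ih =>
    by_cases hy : y' ∈ D
    · exact ⟨x', y', Walk.nil, h, Q, rfl, hy, by simpa using hx⟩
    · obtain ⟨a, ha, haD⟩ := hD
      rw [Walk.support_cons, List.mem_cons] at ha
      rcases ha with rfl | ha
      · exact absurd haD hx
      · obtain ⟨g, f, X, h', Y, rfl, hf, hX⟩ := ih hy ⟨a, ha, haD⟩
        refine ⟨g, f, Walk.cons h X, h', Y, rfl, hf, ?_⟩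
        intro b hb
        rw [Walk.support_cons, List.mem_cons] at hb
        rcases hb with rfl | hb
        exacts [hx, hX b hb]

/-- If a rooted tree contains a source vertex `x ∉ D` and a vertex `f ∈ D`, then close to `x` there
is a vertex outside `D` that is a tree neighbour, of the kind collected in `treeNbrs`, of some vertex
of `D`. -/
theorem exists_treeNbr_near (hwt : ∀ e ∈ G.edgeSet, 1 ≤ wt e) {T : G.Subgraph} {S D : Set V}
    {r x f : V} {a b : ℝ} (hr : r ∈ S) (hx : x ∈ S) (hxD : x ∉ D) (hf : f ∈ D)
    (ha : HasDepth wt T r x a) (hb : HasDepth wt T r f b) :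
    ∃ f' ∈ D, f' ∈ T.verts ∧ ∃ g ∈ treeNbrs T S r f', ∃ Q : G.Walk x g,
      (∀ q ∈ Q.support, q ∈ Dᶜ) ∧ wlen wt Q ≤ a + b := by
  obtain ⟨-, P, hP, rfl⟩ := ha
  obtain ⟨-, R, hR, rfl⟩ := hb
  have hle := T.spanningCoe_le
  have key : ∀ {y z : V} (W : T.spanningCoe.Walk y z), 0 ≤ wlen wt W := fun W => by
    rw [← wlen_mapLe hle]
    exact wlen_nonneg hwt _
  by_cases hPD : ∃ q ∈ P.support, q ∈ D
  -- `D` is entered on the way up, from a child `g` of `f'`; `g` is a trunk vertex because it lies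
  -- between the sources `x` and `r`.
  · obtain ⟨g, f', X, h, Y, rfl, hf', hX⟩ := exists_first_mem P hxD hPD
    have hadj : T.Adj g f' := h
    refine ⟨f', hf', T.edge_vert hadj.symm, g, Or.inr ⟨⟨_, hP.of_append_right, by simp, by simp⟩,
      T.edge_vert hadj, x, hx, r, hr, _, hP, by simp⟩, X.mapLe hle, ?_, ?_⟩
    · intro q hq
      rw [Walk.support_mapLe_eq_support] at hq
      exact hX q hq
    · rw [wlen_mapLe, wlen_append]
      linarith [key R, key (Walk.cons h Y)]
  -- The way up avoids `D`, so `D` is entered on the way down from the root, from the parent of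
  -- `f'`.
  · have hPD' : ∀ q ∈ P.support, q ∉ D := fun q hq hqD => hPD ⟨q, hq, hqD⟩
    obtain ⟨g, f', X, h, Y, hXY, hf', hX⟩ := exists_first_mem R.reverse
      (hPD' r P.end_mem_support) ⟨f, by simp, hf⟩
    have hadj : T.Adj g f' := h
    have hlen : wlen wt R = wlen wt X + wlen wt (Walk.cons h Y) := by
      rw [← wlen_reverse, hXY, wlen_append]
    have hpath : (Walk.cons h.symm X.reverse).IsPath := by
      rw [← Walk.reverse_concat X h]
      refine Walk.IsPath.reverse (Walk.IsPath.of_append_left (q := Y) ?_)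
      rw [Walk.concat_append, ← hXY]
      exact hR.reverse
    refine ⟨f', hf', T.edge_vert hadj.symm, g, Or.inl ⟨_, hpath, Nat.succ_pos _, Walk.snd_cons _ _⟩,
      (P.append X).mapLe hle, ?_, ?_⟩
    · intro q hq
      rw [Walk.support_mapLe_eq_support, Walk.mem_support_append_iff] at hq
      rcases hq with hq | hq
      exacts [hPD' q hq, hX q hq]
    · rw [wlen_mapLe, wlen_append]
      linarith [key (Walk.cons h Y)]

end Tree

/-! ### Levels -/

section Level

variable {V : Type*} {p : ℕ} {U : ℕ → Set V}

theorem le_level {v : V} {l : ℕ} (hl : 1 ≤ l) (hlp : l ≤ p) (hv : v ∈ U l) : l ≤ level p U v :=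
  le_csSup ⟨p, fun _ h => h.2.1⟩ ⟨hl, hlp, hv⟩

/-- `U 1 = Set.univ` makes the set of levels nonempty, so the supremum is attained. -/
theorem level_mem (hp : 1 ≤ p) (hroot : U 1 = Set.univ) (v : V) :
    1 ≤ level p U v ∧ level p U v ≤ p ∧ v ∈ U (level p U v) :=
  Nat.sSup_mem (s := {l | 1 ≤ l ∧ l ≤ p ∧ v ∈ U l}) ⟨1, le_rfl, hp, by simp [hroot]⟩
    ⟨p, fun _ h => h.2.1⟩

/-- Maximality of the level suffices, without nestedness of the `U`; for `l = p` the convention `U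
(p + 1) = ∅` takes over. -/
theorem notMem_of_level_le (hlast : U (p + 1) = ∅) {v : V} {l : ℕ} (hlp : l ≤ p)
    (hv : level p U v ≤ l) : v ∉ U (l + 1) := by
  intro h
  rcases hlp.lt_or_eq with hlt | rfl
  · have := le_level (p := p) (by omega) hlt h
    omega
  · simp [hlast] at h

end Level

/-! ### Segments are short -/

/-- Since `e < 3 ≤ n`; this keeps `2k - 1` and `4k - 2` positive. -/
theorem one_lt_kpar {V : Type*} [Fintype V] (hn : 3 ≤ Fintype.card V) : 1 < kpar V := by
  rw [kpar, Real.lt_log_iff_exp_lt (by positivity)]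
  have h : (3 : ℝ) ≤ Fintype.card V := by exact_mod_cast hn
  linarith [Real.exp_one_lt_d9]

/-- Equal floors put the logarithms less than `1` apart, so `b / a < 1 + ε`. -/
theorem sub_le_mul_of_floor_logb_eq {ε a b : ℝ} (hε : 0 < ε) (ha : 0 < a) (hb : 0 < b)
    (h : ⌊Real.logb (1 + ε) a⌋ = ⌊Real.logb (1 + ε) b⌋) : b - a ≤ ε * a := by
  have h1 : (1 : ℝ) < 1 + ε := by linarith
  have h2 : Real.logb (1 + ε) b < Real.logb (1 + ε) a + 1 := by
    have := Int.lt_floor_add_one (Real.logb (1 + ε) b)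
    have := Int.floor_le (Real.logb (1 + ε) a)
    rw [h] at this
    linarith
  have h3 : Real.logb (1 + ε) a + 1 = Real.logb (1 + ε) (a * (1 + ε)) := by
    rw [Real.logb_mul ha.ne' (by positivity), Real.logb_self_eq_one h1]
  rw [h3, Real.logb_lt_logb_iff h1 hb (by positivity)] at h2
  linarith

section Segment

variable {V : Type*} {G : SimpleGraph V} {wt : Sym2 V → ℝ}

/-- The length of an `ε`-segment is at most `ε` times the distance, along the path, of each of its
positions from the nearer end of the path. -/
theorem SameSegment.wlen_le (hwt : ∀ e ∈ G.edgeSet, 1 ≤ wt e) {ε : ℝ} (hε : 0 < ε) {x y : V}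
    {P : G.Walk x y} {l r m : ℕ} (h : SameSegment wt ε P l r) (hlm : l ≤ m) (hmr : m ≤ r) :
    wlen wt ((P.take r).drop l) ≤ ε * min (wlen wt (P.take m)) (wlen wt (P.drop m)) := by
  obtain ⟨⟨hl0, hlP⟩, ⟨hr0, hrP⟩, h⟩ := h
  have hpt : ∀ i, 0 < i → i < P.length → 0 < wlen wt (P.take i) := fun i h0 hi =>
    wlen_pos hwt _ (by rw [Walk.take_length]; omega)
  have hpd : ∀ i, i < P.length → 0 < wlen wt (P.drop i) := fun i hi =>
    wlen_pos hwt _ (by rw [Walk.drop_length]; omega)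
  have hW := wlen_take_add_wlen_drop (wt := wt) (P.take r) l
  rw [wlen_take_take P (hlm.trans hmr)] at hW
  have el := wlen_take_add_wlen_drop (wt := wt) P l
  have em := wlen_take_add_wlen_drop (wt := wt) P m
  have er := wlen_take_add_wlen_drop (wt := wt) P r
  have tlm := wlen_take_mono hwt P hlm
  have tmr := wlen_take_mono hwt P hmr
  -- In the left half, prefix lengths are the smaller ones and are least at `l`; in the right half,
  -- suffix lengths are, and are least at `r`.
  rcases h with ⟨-, h2, h3⟩ | ⟨h1, -, h3⟩
  · have := sub_le_mul_of_floor_logb_eq hε (hpt l hl0 hlP) (hpt r hr0 hrP) h3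
    rw [min_eq_left (by linarith)]
    have := mul_le_mul_of_nonneg_left tlm hε.le
    linarith
  · have := sub_le_mul_of_floor_logb_eq hε (hpd r hrP) (hpd l hlP) h3.symm
    rw [min_eq_right (by linarith)]
    have := mul_le_mul_of_nonneg_left (wlen_drop_anti hwt P hmr) hε.le
    linarith

end Segment

/-! ### Shortest paths in the graphs of the levels -/

/-- A shortest path `A` of `G - D` that is short in comparison with the distance to `V(H)` from each
of its vertices is a shortest path in `G_i`, where `i` is the highest level of its vertices. -/
theorem exists_isShortestIn_lowVerts {V : Type*} [Fintype V] (hn : 3 ≤ Fintype.card V)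
    {G : SimpleGraph V} {wt : Sym2 V → ℝ} (hwt : ∀ e ∈ G.edgeSet, 1 ≤ wt e) {d : ℕ} {c : ℝ}
    {cov : Set V → Set V → V → G.Subgraph} (hcov : IsCoverChoice G wt cov)
    {p : ℕ} {U : ℕ → Set V} (hU : IsHierarchyPath d c cov p U) {D : Set V} {s t x y : V}
    {A : G.Walk x y} (hA : IsShortestIn G wt Dᶜ A)
    (hfar : ∀ a ∈ A.support, ∀ z ∈ auxVerts cov p U D s t, ∀ Q : G.Walk a z,
      IsShortestIn G wt Dᶜ Q → (4 * kpar V - 2) * wlen wt A < wlen wt Q) :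
    ∃ i, (1 ≤ i ∧ i ≤ p) ∧ IsShortestIn G wt (lowVerts p U i) A := by
  classical
  obtain ⟨a, ha, hmax⟩ := Set.exists_max_image {a | a ∈ A.support} (level p U)
    (Set.toFinite _) ⟨x, A.start_mem_support⟩
  obtain ⟨hi1, hip, hai⟩ := level_mem hU.one_le hU.root a
  refine ⟨level p U a, ⟨hi1, hip⟩, hmax, fun Q hQ => ?_⟩
  set i := level p U a with hi
  by_contra! hlt
  have hfD : ∃ f ∈ Q.support, f ∈ D := by
    by_contra! hno
    exact absurd (hA.2 Q hno) (not_le.2 hlt)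
  obtain ⟨f, hfQ, hfD⟩ := hfD
  -- Choosing `a` of the highest level makes it a source of the cover whose removed set `U (i + 1)`
  -- misses both `A` and `Q`.
  have haS : a ∈ U i \ U (i + 1) := ⟨hai, notMem_of_level_le hU.last hip le_rfl⟩
  have hcover := hcov (U (i + 1)) (U i \ U (i + 1)) Set.disjoint_sdiff_left
  set W := (A.takeUntil a ha).reverse.append (Q.takeUntil f hfQ) with hWdef
  have hWsup : ∀ q ∈ W.support, q ∈ (U (i + 1))ᶜ := by
    intro q hq
    refine notMem_of_level_le hU.last hip ?_
    rw [hWdef, Walk.mem_support_append_iff, Walk.support_reverse, List.mem_reverse] at hq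
    rcases hq with hq | hq
    · exact hmax q (A.support_takeUntil_subset_support ha hq)
    · exact hQ q (Q.support_takeUntil_subset_support hfQ hq)
  have hWlen : wlen wt W ≤ 2 * wlen wt A := by
    rw [hWdef, wlen_append, wlen_reverse]
    have h1 : wlen wt (A.takeUntil a ha) ≤ wlen wt A :=
      wlen_le_of_edges_sublist hwt (A.isSubwalk_takeUntil ha).edges_isInfix.sublist
    have h2 : wlen wt (Q.takeUntil f hfQ) ≤ wlen wt Q :=
      wlen_le_of_edges_sublist hwt (Q.isSubwalk_takeUntil hfQ).edges_isInfix.sublist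
    linarith
  obtain ⟨W', hW'⟩ := exists_isShortestIn hwt W hWsup
  obtain ⟨r, hr, α, β, hα, hβ, hαβ⟩ := hcover.stretch a haS f W' hW'
  obtain ⟨f', hf'D, hf'T, g, hg, R, hR, hRlen⟩ :=
    exists_treeNbr_near hwt hr haS (hA.1 a ha) hfD hα hβ
  obtain ⟨R', hR'⟩ := exists_isShortestIn hwt R hR
  have hgH : g ∈ auxVerts cov p U D s t :=
    ⟨Or.inr (Set.mem_biUnion hf'D ⟨i, hi1, hip, r, hr, hf'T, hg⟩), hR g R.end_mem_support⟩
  have h1 := hfar a ha g hgH R' hR'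
  have h2 := hR'.2 R hR
  have h3 : (2 * kpar V - 1) * wlen wt W' ≤ (2 * kpar V - 1) * (2 * wlen wt A) :=
    mul_le_mul_of_nonneg_left ((hW'.2 W hWsup).trans hWlen)
      (by linarith [one_lt_kpar hn])
  linarith

end VSDO

/-! ### Assembling the segment bipath -/

theorem mainTheorem5 {V : Type*} [Fintype V] (hn : 3 ≤ Fintype.card V)
    (G : SimpleGraph V) (wt : Sym2 V → ℝ) (hwt : ∀ e ∈ G.edgeSet, 1 ≤ wt e)
    (d : ℕ) (hd : 2 ≤ d) (c : ℝ) (hc : 1 ≤ c)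
    (cov : Set V → Set V → V → G.Subgraph) (hcov : VSDO.IsCoverChoice G wt cov)
    (p : ℕ) (U : ℕ → Set V) (hU : VSDO.IsHierarchyPath d c cov p U)
    (D : Set V) (hD : D.ncard ≤ d) (s t : V)
    (ε ε₁ ε₅ : ℝ) (hε : 0 < ε) (hε₁ : ε₁ = ε / (2 + ε))
    (hε₅ : ε₅ = ε₁ / (4 * VSDO.kpar V - 2))
    (u v w : V) (P₁ : G.Walk u v) (P₂ : G.Walk v w)
    (hP₁ : VSDO.IsShortestIn G wt Dᶜ P₁) (hP₂ : VSDO.IsShortestIn G wt Dᶜ P₂)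
    (hfar : VSDO.FarAway wt D (VSDO.auxVerts cov p U D s t) ε₁ (P₁.append P₂)) :
    VSDO.IsSegmentBipath wt p U ε₅ (P₁.append P₂) := by
  obtain ⟨P, hP⟩ : ∃ P, P = P₁.append P₂ := ⟨_, rfl⟩
  rw [← hP] at hfar ⊢
  rintro l r ⟨hsame, hext⟩
  have hlr : l ≤ r := (hext r hsame).1
  have hk : 0 < 4 * VSDO.kpar V - 2 := by linarith [VSDO.one_lt_kpar hn]
  have hε₁0 : 0 < ε₁ := by rw [hε₁]; positivity
  have hε₅0 : 0 < ε₅ := by rw [hε₅]; positivity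
  have hmul : (4 * VSDO.kpar V - 2) * ε₅ = ε₁ := by rw [hε₅]; field_simp
  obtain ⟨z, X, Y, hXY, hX, hY⟩ :=
    VSDO.exists_take_drop_eq_append hP₁ hP₂ hP hlr hsame.2.1.2.le
  have hlen : ∀ m, l ≤ m → m ≤ r → (4 * VSDO.kpar V - 2) * VSDO.wlen wt ((P.take r).drop l) ≤
      ε₁ * min (VSDO.wlen wt (P.take m)) (VSDO.wlen wt (P.drop m)) := by
    intro m hlm hmr
    rw [← hmul, mul_assoc _ ε₅]
    exact mul_le_mul_of_nonneg_left (hsame.wlen_le hwt hε₅0 hlm hmr) hk.le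
  have hXYlen : VSDO.wlen wt ((P.take r).drop l) = VSDO.wlen wt X + VSDO.wlen wt Y := by
    rw [hXY, VSDO.wlen_append]
  -- The bound uses the length of the whole segment, so it serves both pieces. Its positions `l + j`
  -- are inner ones of `P`, as far-awayness requires.
  have key : ∀ a ∈ ((P.take r).drop l).support, ∀ z ∈ VSDO.auxVerts cov p U D s t,
      ∀ Q : G.Walk a z, VSDO.IsShortestIn G wt Dᶜ Q →
        (4 * VSDO.kpar V - 2) * VSDO.wlen wt ((P.take r).drop l) < VSDO.wlen wt Q := by
    intro a ha z hz Q hQ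
    obtain ⟨j, rfl, hj⟩ := SimpleGraph.Walk.mem_support_iff_exists_getVert.1 ha
    rw [Walk.drop_length, Walk.take_length] at hj
    have hget : ((P.take r).drop l).getVert j = P.getVert (l + j) := by
      rw [Walk.drop_getVert, Walk.take_getVert, min_eq_right (by omega)]
    by_contra! hle
    have hr := hsame.2.1.2
    have hl := hsame.1.1
    refine hfar ⟨l + j, by omega, by omega, z, hz, Q.copy hget rfl, ?_, ?_⟩
    · exact (VSDO.isShortestIn_copy hget).2 hQ
    · rw [VSDO.wlen_copy]
      exact hle.trans (hlen _ (by omega) (by omega))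
  obtain ⟨i, hi, hXi⟩ := VSDO.exists_isShortestIn_lowVerts hn hwt hcov hU hX fun a ha z hz Q hQ =>
    (mul_le_mul_of_nonneg_left (by linarith [VSDO.wlen_nonneg hwt Y]) hk.le).trans_lt
      (key a (by rw [hXY, Walk.mem_support_append_iff]; exact Or.inl ha) z hz Q hQ)
  obtain ⟨j, hj, hYj⟩ := VSDO.exists_isShortestIn_lowVerts hn hwt hcov hU hY fun a ha z hz Q hQ =>
    (mul_le_mul_of_nonneg_left (by linarith [VSDO.wlen_nonneg hwt X]) hk.le).trans_lt
      (key a (by rw [hXY, Walk.mem_support_append_iff]; exact Or.inr ha) z hz Q hQ)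
  exact ⟨i, j, hi, hj, z, X, Y, hXY, hXi, hYj⟩
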